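/- A digraph on a vertex set $V$ is a pair $G=(V,E)$ with $E\subseteq V\times V$ (loops are allowed). It is a Ferrers digraph if there is a linear order $L$ on $V$ such that $(x,y)\in L$ and $(y,z)\in E$ imply $(x,z)\in E$, for all $x,y,z\in V$. The Ferrers dimension $\operatorname{fd}(G)$ is the smallest number $k\ge 0$ of Ferrers digraphs on $V$ whose intersection is $G$, the intersection of no digraphs being $(V,V\times V)$. There is a polynomial-time $O\!\left(\frac{n\sqrt{\log\log n}}{\sqrt{\log n}}\right)$-factor approximation algorithm for the Ferrers dimension of a digraph on $n$ vertices. That is, there are a function $\rho:\mathbb{N}\to\mathbb{R}$ with $\rho(n)=O\!\left(\frac{n\sqrt{\log\log n}}{\sqrt{\log n}}\right)$ as $n\to\infty$ and an algorithm that, given the adjacency matrix of any digraph $G$ on $n$ vertices, outputs in time polynomial in $n$ a natural number $d$ with $$\operatorname{fd}(G)\le d\le \rho(n)\,\operatorname{fd}(G).$$ -/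

import Mathlib

open Filter Asymptotics

/-! ### Ferrers digraphs and the Ferrers dimension

Digraphs are Mathlib's `Digraph V`: an arbitrary binary relation on `V`, loops allowed. -/

/-- A digraph is a Ferrers digraph if there is a linear order `L` of its vertices such that
`(x, y) ∈ L` and `(y, z) ∈ E` imply `(x, z) ∈ E`. -/
def IsFerrers {V : Type*} (G : Digraph V) : Prop :=
  ∃ L : LinearOrder V, ∀ x y z : V, L.le x y → G.Adj y z → G.Adj x z

/-- `G` is the intersection of `k` Ferrers digraphs on its vertex set.
The intersection of no digraphs is the complete digraph with all loops. -/
def IsFerrersIntersection {V : Type*} (G : Digraph V) (k : ℕ) : Prop :=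
  ∃ F : Fin k → Digraph V, (∀ i, IsFerrers (F i)) ∧ ⨅ i, F i = G

/-- The Ferrers dimension: the smallest number of Ferrers digraphs whose intersection is `G`. -/
noncomputable def ferrersDim {V : Type*} (G : Digraph V) : ℕ :=
  sInf {k | IsFerrersIntersection G k}

/-- On `n` vertices the minimum in `ferrersDim` is over a nonempty set. -/
theorem isFerrersIntersection_card {n : ℕ} (G : Digraph (Fin n)) :
    IsFerrersIntersection G n := by
  classical
  refine ⟨fun i => ⟨fun y z => y = i → G.Adj y z⟩, fun i => ?_, ?_⟩
  · -- order the vertices with `i` as the greatest one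
    let f : Fin n → ℕ ×ₗ Fin n := fun x => toLex (if x = i then 1 else 0, x)
    have hf : Function.Injective f := fun x y h => by
      have h1 := congrArg (fun p => (ofLex p).2) h
      simpa [f] using h1
    refine ⟨LinearOrder.lift' f hf, fun x y z hxy hyz hx => ?_⟩
    have hle : f x ≤ f y := hxy
    rw [Prod.Lex.le_iff] at hle
    subst hx
    by_cases hy : y = x
    · subst hy; exact hyz rfl
    · simp [f, hy] at hle
  · ext y z
    rw [Digraph.iInf_adj]
    exact ⟨fun h => h y rfl, fun h i _ => h⟩

/-! ### The machine model

A random access machine with structured control flow. The memory has registers `0, 1, 2, …` and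
arrays `0, 1, 2, …`, each array with cells `0, 1, 2, …`; registers and cells hold natural numbers.
The only arithmetic is addition and truncated subtraction, so in `t` steps the bit length of the
numbers grows by at most `t + O(1)`, and polynomial time for the unit cost below is polynomial
time on a Turing machine. -/

namespace Ram

/-- The contents of the memory. -/
@[ext] structure Store where
  reg : ℕ → ℕ
  arr : ℕ → ℕ → ℕ

/-- Put the value `v` into register `x`. -/
def Store.setReg (s : Store) (x v : ℕ) : Store :=
  { s with reg := Function.update s.reg x v }

/-- Put the value `v` into cell `i` of array `a`. -/
def Store.setArr (s : Store) (a i v : ℕ) : Store :=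
  { s with arr := Function.update s.arr a (Function.update (s.arr a) i v) }

/-- Programs. The names of the registers and arrays in a program, and its constants, are literals
of the program text; only the index of an array cell is taken from a register. -/
inductive Program where
  /-- do nothing -/
  | skip
  /-- `x := c` -/
  | const (x c : ℕ)
  /-- `x := y + z` -/
  | add (x y z : ℕ)
  /-- `x := max (y - z) 0` -/
  | sub (x y z : ℕ)
  /-- `x := a[i]`, the index being the content of register `i` -/
  | load (x a i : ℕ)
  /-- `a[i] := x`, the index being the content of register `i` -/
  | store (a i x : ℕ)
  /-- first `p`, then `q` -/
  | seq (p q : Program)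
  /-- `p` if register `x` is not zero, else `q` -/
  | ite (x : ℕ) (p q : Program)
  /-- repeat `p` while register `x` is not zero -/
  | while (x : ℕ) (p : Program)

/-- `Run p s t s'`: started on the store `s`, the program `p` halts after exactly `t` steps with
the store `s'`. Every elementary instruction and every test is one step. -/
inductive Run : Program → Store → ℕ → Store → Prop
  | skip (s : Store) : Run .skip s 1 s
  | const (x c : ℕ) (s : Store) : Run (.const x c) s 1 (s.setReg x c)
  | add (x y z : ℕ) (s : Store) : Run (.add x y z) s 1 (s.setReg x (s.reg y + s.reg z))
  | sub (x y z : ℕ) (s : Store) : Run (.sub x y z) s 1 (s.setReg x (s.reg y - s.reg z))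
  | load (x a i : ℕ) (s : Store) : Run (.load x a i) s 1 (s.setReg x (s.arr a (s.reg i)))
  | store (a i x : ℕ) (s : Store) : Run (.store a i x) s 1 (s.setArr a (s.reg i) (s.reg x))
  | seq {p q : Program} {s s' s'' : Store} {t u : ℕ} (hp : Run p s t s') (hq : Run q s' u s'') :
      Run (.seq p q) s (t + u) s''
  | ite_true {x : ℕ} {p q : Program} {s s' : Store} {t : ℕ} (hx : s.reg x ≠ 0)
      (hp : Run p s t s') : Run (.ite x p q) s (t + 1) s'
  | ite_false {x : ℕ} {p q : Program} {s s' : Store} {t : ℕ} (hx : s.reg x = 0)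
      (hq : Run q s t s') : Run (.ite x p q) s (t + 1) s'
  | while_true {x : ℕ} {p : Program} {s s' s'' : Store} {t u : ℕ} (hx : s.reg x ≠ 0)
      (hp : Run p s t s') (hw : Run (.while x p) s' u s'') :
      Run (.while x p) s (t + u + 1) s''
  | while_false {x : ℕ} {p : Program} {s : Store} (hx : s.reg x = 0) :
      Run (.while x p) s 1 s

open Classical in
/-- The input for a digraph `G` on the vertices `0, …, n - 1`: register `0` holds `n`, array `0`
holds the adjacency matrix of `G` row by row, and the rest of the memory is zero. -/
noncomputable def input {n : ℕ} (G : Digraph (Fin n)) : Store where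
  reg x := if x = 0 then n else 0
  arr a k := if a = 0 ∧ ∃ i j : Fin n, k = (i : ℕ) * n + (j : ℕ) ∧ G.Adj i j then 1 else 0

/-- On the input `G` the program `p` halts within `T` steps, with the number `d` in register `1`. -/
def Outputs (p : Program) {n : ℕ} (G : Digraph (Fin n)) (T d : ℕ) : Prop :=
  ∃ (t : ℕ) (s : Store), Run p (input G) t s ∧ t ≤ T ∧ s.reg 1 = d

/-- `p` is a polynomial time algorithm that computes the numerical parameter `f` of digraphs
approximately, within the factor `ρ n` on digraphs with `n` vertices: it outputs a number between
`f G` and `ρ n * f G`. -/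
def IsPolyTimeApprox (p : Program) (f : ∀ {n : ℕ}, Digraph (Fin n) → ℕ) (ρ : ℕ → ℝ) : Prop :=
  ∃ T : Polynomial ℕ, ∀ (n : ℕ) (G : Digraph (Fin n)),
    ∃ d : ℕ, Outputs p G (T.eval n) d ∧ f G ≤ d ∧ (d : ℝ) ≤ ρ n * f G

end Ram

/-!
The vertices are split into blocks of `k` vertices. A block of `G` keeps the arcs out of its `k`
vertices and gets all arcs out of the others. As the Ferrers property says that the rows of the
adjacency matrix form a chain, blocks of Ferrers digraphs are Ferrers digraphs, so a block has
dimension at most `fd(G)`. Since `G` is the intersection of its blocks, the sum of their dimensions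
is between `fd(G)` and the number of blocks times `fd(G)`.

The dimension of a block is at most `k` and is found by brute force. A Ferrers digraph that contains
`G` amounts on a block to a list of the `k` vertices, sorted such that for every `y` those without
an arc to `y` form a final segment. So at most `k` lists of length `k` have to be tried, whose
entries are the base `k` digits of a number below `k ^ (k * k)`. With the largest `k` such that
`k ^ (k * k) ≤ n`, a search over all numbers below `n` suffices, and `k` has the order of magnitude
`√(log n / log log n)`.

No explicit program is needed, since the functions and predicates that are computable in polynomial
time are closed under composition, bounded recursion, sums and bounded quantifiers.
-/

/-! ### Blocks of Ferrers digraphs -/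

section FerrersDigraphs

variable {V : Type*} {G H : Digraph V} {r s : ℕ}

theorem isFerrers_iff_total : IsFerrers G ↔
    ∀ x y, (∀ z, G.Adj x z → G.Adj y z) ∨ ∀ z, G.Adj y z → G.Adj x z := by
  classical
  constructor
  · rintro ⟨L, hL⟩ x y
    exact (L.le_total y x).imp (fun h z => hL y x z h) (fun h z => hL x y z h)
  · intro hG
    -- A linear extension of strict containment of rows lists the larger rows first.
    let rowOrder : PartialOrder V :=
      { le := fun x y => x = y ∨ {z | G.Adj y z} ⊂ {z | G.Adj x z}
        le_refl := fun _ => .inl rfl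
        le_trans := by
          rintro x y z (rfl | hxy) (rfl | hyz)
          exacts [.inl rfl, .inr hyz, .inr hxy, .inr (hyz.trans hxy)]
        le_antisymm := by
          rintro x y (rfl | hxy) (hyx | hyx)
          exacts [rfl, rfl, hyx.symm, (hxy.asymm hyx).elim] }
    obtain ⟨L, hL⟩ : ∃ L : LinearOrder V, ∀ x y, rowOrder.le x y → L.le x y :=
      ⟨(inferInstance : LinearOrder (LinearExtension V)), toLinearExtension.monotone⟩
    refine ⟨L, fun x y z hxy hyz => ?_⟩
    rcases hG x y with hrow | hrow
    · by_contra hxz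
      have hyx : L.le y x := hL _ _ (.inr ⟨hrow, fun h => hxz (h hyz)⟩)
      exact hxz (L.le_antisymm _ _ hxy hyx ▸ hyz)
    · exact hrow z hyz

theorem isFerrersIntersection_iInf {ι : Type*} [Fintype ι] {F : ι → Digraph V}
    (hF : ∀ i, IsFerrers (F i)) : IsFerrersIntersection (⨅ i, F i) (Fintype.card ι) :=
  ⟨F ∘ (Fintype.equivFin ι).symm, fun _ => hF _, (Fintype.equivFin ι).symm.iInf_comp⟩

theorem IsFerrersIntersection.inf (hG : IsFerrersIntersection G r)
    (hH : IsFerrersIntersection H s) : IsFerrersIntersection (G ⊓ H) (r + s) := by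
  obtain ⟨F, hF, rfl⟩ := hG
  obtain ⟨F', hF', rfl⟩ := hH
  simpa [iInf_sum] using
    isFerrersIntersection_iInf (F := Sum.elim F F') (Sum.forall.2 ⟨hF, hF'⟩)

theorem isFerrersIntersection_top (r : ℕ) : IsFerrersIntersection (⊤ : Digraph V) r :=
  ⟨fun _ => ⊤, fun _ => isFerrers_iff_total.2 fun _ _ => .inl fun _ _ => trivial, by simp⟩

theorem IsFerrersIntersection.mono (h : IsFerrersIntersection G r) (hrs : r ≤ s) :
    IsFerrersIntersection G s := by
  simpa [hrs] using h.inf (isFerrersIntersection_top (s - r))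

/-- `G` with all arcs out of vertices outside of `S` added, so that only the rows of the adjacency
matrix indexed by `S` matter. It is how the rows of a digraph are split into blocks without
changing the vertex set. -/
def fillOutside (G : Digraph V) (S : Set V) : Digraph V where
  Adj x y := x ∈ S → G.Adj x y

theorem fillOutside_univ (G : Digraph V) : fillOutside G .univ = G := by
  ext x y
  simp [fillOutside]

theorem fillOutside_iInf {ι : Sort*} (F : ι → Digraph V) (S : Set V) :
    fillOutside (⨅ i, F i) S = ⨅ i, fillOutside (F i) S := by
  ext x y
  simpa [fillOutside] using forall_comm

theorem fillOutside_iUnion {ι : Sort*} (G : Digraph V) (S : ι → Set V) :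
    fillOutside G (⋃ i, S i) = ⨅ i, fillOutside G (S i) := by
  ext x y
  simp [fillOutside]

theorem IsFerrers.fillOutside (hG : IsFerrers G) (S : Set V) : IsFerrers (fillOutside G S) := by
  rw [isFerrers_iff_total] at hG ⊢
  intro x y
  by_cases hx : x ∈ S
  · by_cases hy : y ∈ S
    · simpa [_root_.fillOutside, hx, hy] using hG x y
    · exact .inl fun z _ h => absurd h hy
  · exact .inr fun z _ h => absurd h hx

theorem isFerrers_fillOutside_singleton (G : Digraph V) (x : V) :
    IsFerrers (fillOutside G {x}) := by
  refine isFerrers_iff_total.2 fun y z => ?_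
  by_cases hy : y = x
  · by_cases hz : z = x
    · exact .inl fun _ => by rw [hy, hz]; exact id
    · exact .inl fun _ _ h => absurd h hz
  · exact .inr fun _ _ h => absurd h hy

theorem IsFerrersIntersection.fillOutside (h : IsFerrersIntersection G r) (S : Set V) :
    IsFerrersIntersection (fillOutside G S) r := by
  obtain ⟨F, hF, rfl⟩ := h
  exact ⟨fun i => _root_.fillOutside (F i) S, fun i => (hF i).fillOutside S,
    (fillOutside_iInf F S).symm⟩

theorem isFerrersIntersection_fillOutside_range {ι : Type*} [Fintype ι] (G : Digraph V)
    (e : ι → V) : IsFerrersIntersection (fillOutside G (Set.range e)) (Fintype.card ι) := by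
  rw [← Set.iUnion_singleton_eq_range, fillOutside_iUnion]
  exact isFerrersIntersection_iInf fun i => isFerrers_fillOutside_singleton G (e i)

section Finite

variable [Finite V]

theorem isFerrersIntersection_ferrersDim (G : Digraph V) :
    IsFerrersIntersection G (ferrersDim G) := by
  have := Fintype.ofFinite V
  refine Nat.sInf_mem (s := {k | IsFerrersIntersection G k}) ⟨Fintype.card V, ?_⟩
  simpa [fillOutside_univ] using isFerrersIntersection_fillOutside_range G (id : V → V)

theorem ferrersDim_le_iff : ferrersDim G ≤ r ↔ IsFerrersIntersection G r :=
  ⟨(isFerrersIntersection_ferrersDim G).mono, fun h => Nat.sInf_le h⟩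

theorem ferrersDim_fillOutside_le (G : Digraph V) (S : Set V) :
    ferrersDim (fillOutside G S) ≤ ferrersDim G :=
  ferrersDim_le_iff.2 ((isFerrersIntersection_ferrersDim G).fillOutside S)

theorem ferrersDim_fillOutside_range_le_card {ι : Type*} [Fintype ι] (G : Digraph V) (e : ι → V) :
    ferrersDim (fillOutside G (Set.range e)) ≤ Fintype.card ι :=
  ferrersDim_le_iff.2 (isFerrersIntersection_fillOutside_range G e)

theorem isFerrersIntersection_finset_inf {ι : Type*} (t : Finset ι) (G : ι → Digraph V) :
    IsFerrersIntersection (t.inf G) (∑ i ∈ t, ferrersDim (G i)) := by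
  classical
  induction t using Finset.induction_on with
  | empty => simpa using isFerrersIntersection_top 0
  | insert i t hi ih =>
    rw [Finset.inf_insert, Finset.sum_insert hi]
    exact (isFerrersIntersection_ferrersDim (G i)).inf ih

theorem ferrersDim_le_sum_fillOutside {ι : Type*} (G : Digraph V) (t : Finset ι) (S : ι → Set V)
    (hS : ⋃ i ∈ t, S i = .univ) : ferrersDim G ≤ ∑ i ∈ t, ferrersDim (fillOutside G (S i)) := by
  refine ferrersDim_le_iff.2 ?_
  conv => arg 1; rw [← fillOutside_univ G, ← hS]
  simpa only [fillOutside_iUnion, Finset.inf_eq_iInf] using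
    isFerrersIntersection_finset_inf t fun i => fillOutside G (S i)

end Finite

/-- The row of `x` is excluded from the column of `y` by the list `u` of vertices: from some
occurrence of `x` on, no vertex of the list has an arc to `y`. -/
def IsExcluded {k : ℕ} (G : Digraph V) (u : Fin k → V) (x y : V) : Prop :=
  ∃ l, u l = x ∧ ∀ l' ≥ l, ¬ G.Adj (u l') y

/-- The digraph of all pairs that are not excluded by the list `u`. -/
def listDigraph {k : ℕ} (G : Digraph V) (u : Fin k → V) : Digraph V where
  Adj x y := ¬ IsExcluded G u x y

variable {k : ℕ}

theorem isFerrers_listDigraph (G : Digraph V) (u : Fin k → V) : IsFerrers (listDigraph G u) := by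
  refine isFerrers_iff_total.2 fun x y => ?_
  by_contra! ⟨⟨z, hxz, hyz⟩, z', hyz', hxz'⟩
  obtain ⟨l, hly, hl⟩ := not_not.1 hyz
  obtain ⟨l', hlx, hl'⟩ := not_not.1 hxz'
  rcases le_total l l' with h | h
  · exact hxz ⟨l', hlx, fun m hm => hl m (h.trans hm)⟩
  · exact hyz' ⟨l, hly, fun m hm => hl' m (h.trans hm)⟩

theorem IsExcluded.not_adj {u : Fin k → V} {x y : V} (h : IsExcluded G u x y) : ¬ G.Adj x y := by
  obtain ⟨l, rfl, hl⟩ := h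
  exact hl l le_rfl

theorem IsFerrers.exists_perm_isExcluded {F : Digraph V} (hF : IsFerrers F) (hGF : G ≤ F)
    (e : Fin k → V) :
    ∃ σ : Equiv.Perm (Fin k), ∀ j y, ¬ F.Adj (e j) y → IsExcluded G (e ∘ σ) (e j) y := by
  obtain ⟨L, hL⟩ := hF
  -- Sorted by `L`, the vertices without an arc of `F` to `y` form a final segment of the list.
  refine ⟨Tuple.sort e, fun j y hj => ⟨(Tuple.sort e).symm j, by simp, fun l hl hadj => hj ?_⟩⟩
  refine hL _ _ y ?_ (hGF hadj)
  simpa using Tuple.monotone_sort e hl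

theorem isFerrersIntersection_fillOutside_range_iff {e : Fin k → V} :
    IsFerrersIntersection (fillOutside G (Set.range e)) r ↔
      ∃ σ : Fin r → Fin k → Fin k, ∀ j y, ¬ G.Adj (e j) y →
        ∃ i, IsExcluded G (e ∘ σ i) (e j) y := by
  constructor
  · rintro ⟨F, hF, hG⟩
    have hGF (i : Fin r) : G ≤ F i := fun x y hxy =>
      (hG.ge.trans (iInf_le F i)) fun _ => hxy
    choose σ hσ using fun i => (hF i).exists_perm_isExcluded (hGF i) e
    refine ⟨fun i => σ i, fun j y hjy => ?_⟩
    have hnot : ¬ (⨅ i, F i).Adj (e j) y := fun h => hjy ((hG ▸ h) ⟨j, rfl⟩)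
    rw [Digraph.iInf_adj, not_forall] at hnot
    exact hnot.imp fun i hi => hσ i j y hi
  · rintro ⟨σ, hσ⟩
    refine ⟨fun i => listDigraph G (e ∘ σ i), fun i => isFerrers_listDigraph _ _, ?_⟩
    ext x y
    rw [Digraph.iInf_adj]
    constructor
    · rintro h ⟨j, rfl⟩
      by_contra hjy
      obtain ⟨i, hi⟩ := hσ j y hjy
      exact h i hi
    · rintro h i hi
      obtain ⟨l, hl, -⟩ := id hi
      exact hi.not_adj (h ⟨_, hl⟩)

end FerrersDigraphs

/-! ### Computability in polynomial time -/

namespace Ram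

/-- Total correctness with a time bound: started on `s`, the program `p` halts within `T` steps, in
a store that satisfies `Q`. -/
def HaltsWithin (p : Program) (s : Store) (T : ℕ) (Q : Store → Prop) : Prop :=
  ∃ (t : ℕ) (s' : Store), Run p s t s' ∧ t ≤ T ∧ Q s'

section HaltsWithin

variable {p q : Program} {s s' : Store} {T U : ℕ} {Q R : Store → Prop}

theorem Run.haltsWithin (h : Run p s T s') (hQ : Q s') : HaltsWithin p s T Q :=
  ⟨T, s', h, le_rfl, hQ⟩

theorem HaltsWithin.mono (h : HaltsWithin p s T Q) (hTU : T ≤ U) (hQR : ∀ s', Q s' → R s') :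
    HaltsWithin p s U R := by
  obtain ⟨t, s', hrun, ht, hs'⟩ := h
  exact ⟨t, s', hrun, ht.trans hTU, hQR s' hs'⟩

theorem HaltsWithin.seq (hp : HaltsWithin p s T Q) (hq : ∀ s', Q s' → HaltsWithin q s' U R) :
    HaltsWithin (.seq p q) s (T + U) R := by
  obtain ⟨t, s', hrun, ht, hs'⟩ := hp
  obtain ⟨u, s'', hrun', hu, hs''⟩ := hq s' hs'
  exact ⟨t + u, s'', hrun.seq hrun', by omega, hs''⟩

theorem HaltsWithin.while_countdown {x : ℕ} {I : ℕ → Store → Prop}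
    (hx : ∀ c s, I c s → s.reg x = c)
    (hp : ∀ c s, I (c + 1) s → HaltsWithin p s T (I c)) (c : ℕ) (s : Store) (hs : I c s) :
    HaltsWithin (.while x p) s (c * (T + 1) + 1) (I 0) := by
  induction c generalizing s with
  | zero => exact ((Run.while_false (hx 0 s hs)).haltsWithin hs).mono (by omega) fun _ => id
  | succ c ih =>
    obtain ⟨t, s', hrun, ht, hs'⟩ := hp c s hs
    obtain ⟨u, s'', hrun', hu, hs''⟩ := ih s' hs'
    refine ⟨_, s'', .while_true (by rw [hx _ s hs]; omega) hrun hrun', ?_, hs''⟩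
    rw [Nat.succ_mul]
    omega

end HaltsWithin

theorem Store.reg_setReg (s : Store) (x v i : ℕ) :
    (s.setReg x v).reg i = if i = x then v else s.reg i :=
  Function.update_apply ..

/-- The assignment `x := y` for different registers `x` and `y`. -/
def Program.copy (x y : ℕ) : Program :=
  .seq (.const x 0) (.add x x y)

theorem run_copy {x y : ℕ} (h : y ≠ x) (s : Store) :
    Run (.copy x y) s 2 (s.setReg x (s.reg y)) := by
  have hrun := (Run.const x 0 s).seq (.add x x y _)
  simpa [Program.copy, Store.setReg, Function.update_of_ne h] using hrun

/-- `s'` agrees with `s` on the registers below `M` and on all arrays. Subprograms that work above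
`M` preserve the rest of the memory in this sense. -/
def AgreeBelow (M : ℕ) (s s' : Store) : Prop :=
  (∀ i < M, s'.reg i = s.reg i) ∧ s'.arr = s.arr

section AgreeBelow

variable {M N : ℕ} {s s' s'' : Store}

theorem AgreeBelow.refl (M : ℕ) (s : Store) : AgreeBelow M s s :=
  ⟨fun _ _ => rfl, rfl⟩

theorem AgreeBelow.trans (h : AgreeBelow M s s') (h' : AgreeBelow M s' s'') :
    AgreeBelow M s s'' :=
  ⟨fun i hi => (h'.1 i hi).trans (h.1 i hi), h'.2.trans h.2⟩

theorem AgreeBelow.anti (h : AgreeBelow N s s') (hMN : M ≤ N) : AgreeBelow M s s' :=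
  ⟨fun i hi => h.1 i (hi.trans_le hMN), h.2⟩

theorem AgreeBelow.setReg {x : ℕ} (h : AgreeBelow M s s') (hx : M ≤ x) (v : ℕ) :
    AgreeBelow M s (s'.setReg x v) :=
  h.trans ⟨fun i hi => by rw [Store.reg_setReg, if_neg (hi.trans_le hx).ne], rfl⟩

end AgreeBelow

/-- An element of `α` is an input that provides variables `0, 1, 2, …` and a read-only array of
bits. Polynomial bounds are relative to its size, which bounds the variables. -/
class Context (α : Type*) where
  var : α → ℕ → ℕ
  cell : α → ℕ → ℕ
  size : α → ℕ
  var_le : ∀ a i, var a i ≤ size a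
  cell_le : ∀ a i, cell a i ≤ 1

/-- The sequence `x, v 0, v 1, …`. As with de Bruijn indices, a new variable gets the index `0` and
moves the others up. -/
def push (x : ℕ) (v : ℕ → ℕ) : ℕ → ℕ
  | 0 => x
  | i + 1 => v i

instance {α : Type*} [Context α] : Context (α × ℕ) where
  var a := push a.2 (Context.var a.1)
  cell a := Context.cell a.1
  size a := Context.size a.1 + a.2
  var_le
    | _, 0 => Nat.le_add_left _ _
    | a, i + 1 => (Context.var_le a.1 i).trans (Nat.le_add_right _ _)
  cell_le a := Context.cell_le a.1

section Context

variable {α : Type*} [Context α]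

/-- `f` is bounded by a polynomial in the size of the context. -/
def PolyBounded (f : α → ℕ) : Prop :=
  ∃ P : Polynomial ℕ, ∀ a, f a ≤ P.eval (Context.size a)

theorem monotone_polynomial_eval (P : Polynomial ℕ) : Monotone fun n => P.eval n := by
  intro m n hmn
  simp only [Polynomial.eval_eq_sum_range]
  gcongr

namespace PolyBounded

variable {f g : α → ℕ}

theorem mono (hg : PolyBounded g) (h : ∀ a, f a ≤ g a) : PolyBounded f :=
  hg.imp fun _ hP a => (h a).trans (hP a)

theorem size : PolyBounded (Context.size : α → ℕ) :=
  ⟨.X, fun a => by simp⟩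

theorem const (c : ℕ) : PolyBounded (fun _ : α => c) :=
  ⟨.C c, fun a => by simp⟩

theorem add (hf : PolyBounded f) (hg : PolyBounded g) : PolyBounded (fun a => f a + g a) := by
  obtain ⟨P, hP⟩ := hf
  obtain ⟨Q, hQ⟩ := hg
  exact ⟨P + Q, fun a => by simpa using add_le_add (hP a) (hQ a)⟩

theorem mul (hf : PolyBounded f) (hg : PolyBounded g) : PolyBounded (fun a => f a * g a) := by
  obtain ⟨P, hP⟩ := hf
  obtain ⟨Q, hQ⟩ := hg
  exact ⟨P * Q, fun a => by simpa using Nat.mul_le_mul (hP a) (hQ a)⟩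

theorem polynomial_eval (P : Polynomial ℕ) (hf : PolyBounded f) :
    PolyBounded (fun a => P.eval (f a)) := by
  obtain ⟨Q, hQ⟩ := hf
  exact ⟨P.comp Q, fun a => by simpa using monotone_polynomial_eval P (hQ a)⟩

theorem comp {β : Type*} [Context β] (hf : PolyBounded f) {φ : β → α}
    (hφ : ∀ x, Context.size (φ x) ≤ Context.size x) : PolyBounded (fun x => f (φ x)) := by
  obtain ⟨P, hP⟩ := hf
  exact ⟨P, fun x => (hP _).trans (monotone_polynomial_eval P (hφ x))⟩

theorem comp_fst (hf : PolyBounded f) : PolyBounded (fun x : α × ℕ => f x.1) :=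
  hf.comp fun _ => Nat.le_add_right _ _

theorem exists_uniform {g : α × ℕ → ℕ} (hg : PolyBounded g) (hf : PolyBounded f) :
    ∃ h : α → ℕ, PolyBounded h ∧ ∀ a, ∀ i ≤ f a, g (a, i) ≤ h a := by
  obtain ⟨P, hP⟩ := hg
  exact ⟨_, (size.add hf).polynomial_eval P, fun a i hi =>
    (hP (a, i)).trans (monotone_polynomial_eval P (Nat.add_le_add_left hi _))⟩

end PolyBounded

/-- The store `s` represents the context `a`: register `ι i` holds the variable `i`, and array `0`
holds the cells. -/
def Represents (ι : ℕ → ℕ) (a : α) (s : Store) : Prop :=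
  (∀ i, s.reg (ι i) = Context.var a i) ∧ s.arr 0 = Context.cell a

theorem Represents.of_agreeBelow {M : ℕ} {ι : ℕ → ℕ} {a : α} {s s' : Store}
    (h : Represents ι a s) (hι : ∀ i, ι i < M) (hs : AgreeBelow M s s') : Represents ι a s' :=
  ⟨fun i => (hs.1 _ (hι i)).trans (h.1 i), by rw [hs.2, h.2]⟩

theorem Represents.push {ι : ℕ → ℕ} {a : α} {s : Store} (h : Represents ι a s) (x : ℕ) :
    Represents (push x ι) (a, s.reg x) s := by
  refine ⟨fun i => ?_, h.2⟩
  cases i with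
  | zero => rfl
  | succ i => exact h.1 i

/-- With the variables in the registers `ι`, the program `p` computes `f` in time `T`: it leaves the
value in register `M` and preserves the registers below `M` and the arrays. -/
def Computes (p : Program) (M : ℕ) (ι : ℕ → ℕ) (f T : α → ℕ) : Prop :=
  ∀ a s, Represents ι a s →
    HaltsWithin p s (T a) fun s' => AgreeBelow M s s' ∧ s'.reg M = f a

/-- `f` is polynomially bounded and computable in polynomial time. The time bound does not depend on
where the program is placed in the memory, so that programs can be combined. -/
def Polytime (f : α → ℕ) : Prop :=
  PolyBounded f ∧ ∃ T : α → ℕ, PolyBounded T ∧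
    ∀ (M : ℕ) (ι : ℕ → ℕ), (∀ i, ι i < M) → ∃ p, Computes p M ι f T

namespace Polytime

variable {f g : α → ℕ}

theorem const (c : ℕ) : Polytime (fun _ : α => c) := by
  refine ⟨.const c, fun _ => 1, .const 1, fun M ι _ => ⟨.const M c, fun a s _ => ?_⟩⟩
  exact (Run.const M c s).haltsWithin
    ⟨(AgreeBelow.refl M s).setReg le_rfl _, by simp [Store.reg_setReg]⟩

theorem var (i : ℕ) : Polytime (fun a : α => Context.var a i) := by
  refine ⟨.mono .size fun a => Context.var_le a i, fun _ => 2, .const 2,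
    fun M ι hι => ⟨.copy M (ι i), fun a s hs => ?_⟩⟩
  exact (run_copy (hι i).ne s).haltsWithin
    ⟨(AgreeBelow.refl M s).setReg le_rfl _, by simp [Store.reg_setReg, hs.1]⟩

theorem snd : Polytime (fun x : α × ℕ => x.2) :=
  var 0

theorem reindex {β : Type*} [Context β] (hf : Polytime f) {φ : β → α} (κ : ℕ → ℕ)
    (hsize : ∀ x, Context.size (φ x) ≤ Context.size x)
    (hvar : ∀ x i, Context.var (φ x) i = Context.var x (κ i))
    (hcell : ∀ x, Context.cell (φ x) = Context.cell x) : Polytime (fun x => f (φ x)) := by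
  obtain ⟨hbound, T, hT, hf⟩ := hf
  refine ⟨hbound.comp hsize, _, hT.comp hsize, fun M ι hι => ?_⟩
  obtain ⟨p, hp⟩ := hf M (ι ∘ κ) fun i => hι _
  exact ⟨p, fun x s hs => hp (φ x) s
    ⟨fun i => (hs.1 (κ i)).trans (hvar x i).symm, hs.2.trans (hcell x).symm⟩⟩

theorem comp_fst (hf : Polytime f) : Polytime (fun x : α × ℕ => f x.1) :=
  hf.reindex (· + 1) (fun _ => Nat.le_add_right _ _) (fun _ _ => rfl) fun _ => rfl

theorem comp_fst_fst_snd {f : α × ℕ → ℕ} (hf : Polytime f) :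
    Polytime (fun x : (α × ℕ) × ℕ => f (x.1.1, x.2)) :=
  hf.reindex (push 0 (· + 2)) (fun _ => Nat.add_le_add_right (Nat.le_add_right _ _) _)
    (by rintro x (_ | i) <;> rfl) fun _ => rfl

theorem cell (hf : Polytime f) : Polytime (fun a => Context.cell a (f a)) := by
  obtain ⟨-, T, hT, hf⟩ := hf
  refine ⟨.mono (.const 1) fun a => Context.cell_le a _, _, hT.add (.const 1), fun M ι hι => ?_⟩
  obtain ⟨p, hp⟩ := hf M ι hι
  refine ⟨.seq p (.load M 0 M), fun a s hs => (hp a s hs).seq fun s' ⟨hagree, hval⟩ => ?_⟩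
  refine (Run.load M 0 M s').haltsWithin ⟨hagree.setReg le_rfl _, ?_⟩
  simp [Store.reg_setReg, hagree.2, hs.2, hval]

theorem binary (op : ℕ → ℕ → ℕ) (instr : ℕ → ℕ → ℕ → Program)
    (hinstr : ∀ x y z s, Run (instr x y z) s 1 (s.setReg x (op (s.reg y) (s.reg z))))
    (hop : ∀ x y, op x y ≤ x + y) (hf : Polytime f) (hg : Polytime g) :
    Polytime (fun a => op (f a) (g a)) := by
  obtain ⟨hfbound, T, hT, hf⟩ := hf
  obtain ⟨hgbound, U, hU, hg⟩ := hg
  refine ⟨(hfbound.add hgbound).mono fun a => hop _ _, _, hT.add (hU.add (.const 1)),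
    fun M ι hι => ?_⟩
  obtain ⟨p, hp⟩ := hf M ι hι
  obtain ⟨q, hq⟩ := hg (M + 1) ι fun i => (hι i).trans M.lt_succ_self
  refine ⟨.seq p (.seq q (instr M M (M + 1))), fun a s hs => ?_⟩
  refine (hp a s hs).seq fun s₁ ⟨hagree₁, hval₁⟩ => ?_
  refine (hq a s₁ (hs.of_agreeBelow hι hagree₁)).seq fun s₂ ⟨hagree₂, hval₂⟩ => ?_
  refine (hinstr M M (M + 1) s₂).haltsWithin
    ⟨(hagree₁.trans (hagree₂.anti M.le_succ)).setReg le_rfl _, ?_⟩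
  simp [Store.reg_setReg, hagree₂.1 M M.lt_succ_self, hval₁, hval₂]

theorem add (hf : Polytime f) (hg : Polytime g) : Polytime (fun a => f a + g a) :=
  binary _ _ Run.add (fun _ _ => le_rfl) hf hg

theorem sub (hf : Polytime f) (hg : Polytime g) : Polytime (fun a => f a - g a) :=
  binary _ _ Run.sub (fun x y => (Nat.sub_le x y).trans (Nat.le_add_right x y)) hf hg

end Polytime

/-- One step `R i ↦ R (i + 1)` of a recursion, where `p` leaves `R (i + 1)` in register `M + 3`.
Register `M` counts the remaining steps, register `M + 1` holds `i` and register `M + 2` holds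
`R i`. -/
def recursionStep (M : ℕ) (p : Program) : Program :=
  .seq p (.seq (.copy (M + 2) (M + 3)) (.seq (.const (M + 3) 1)
    (.seq (.add (M + 1) (M + 1) (M + 3)) (.sub M M (M + 3)))))

/-- The state of the recursion for `R m`, started on the store `s₀`, with `c` steps remaining. -/
structure RecursionState (M : ℕ) (s₀ : Store) (R : ℕ → ℕ) (m c : ℕ) (s : Store) : Prop where
  agree : AgreeBelow M s₀ s
  counter : s.reg M = c
  index : s.reg (M + 1) + c = m
  value : s.reg (M + 2) = R (s.reg (M + 1))

theorem RecursionState.step {M m c B : ℕ} {ι : ℕ → ℕ} {p : Program} {g W : (α × ℕ) × ℕ → ℕ}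
    {R : ℕ → ℕ} {a : α} {s₀ s : Store} (h : RecursionState M s₀ R m (c + 1) s)
    (hι : ∀ i, ι i < M) (hs₀ : Represents ι a s₀)
    (hp : Computes p (M + 3) (push (M + 2) (push (M + 1) ι)) g W)
    (hR : ∀ i, R (i + 1) = g ((a, i), R i)) (hW : ∀ i ≤ m, W ((a, i), R i) ≤ B) :
    HaltsWithin (recursionStep M p) s (B + 5) (RecursionState M s₀ R m c) := by
  have hrep := ((hs₀.of_agreeBelow hι h.agree).push (M + 1)).push (M + 2)
  rw [h.value] at hrep
  have hindex := h.index
  refine ((hp _ s hrep).mono (hW _ (by omega)) fun _ => id).seq fun s₁ ⟨hagree, hval⟩ => ?_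
  have hrun := (run_copy (x := M + 2) (y := M + 3) (by omega) s₁).seq (.seq (.const (M + 3) 1 _)
    (.seq (.add (M + 1) (M + 1) (M + 3) _) (.sub M M (M + 3) _)))
  refine hrun.haltsWithin ⟨?_, ?_, ?_, ?_⟩
  · exact ((((h.agree.trans (hagree.anti (by omega))).setReg (by omega) _).setReg (by omega)
      _).setReg (by omega) _).setReg le_rfl _
  all_goals simp [Store.reg_setReg, hagree.1, hval, h.counter, hR]
  omega

namespace Polytime

variable {f g : α → ℕ}

theorem recursion {z b : α → ℕ} {g : (α × ℕ) × ℕ → ℕ} (R : α → ℕ → ℕ) (hf : Polytime f)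
    (hz : Polytime z) (hg : Polytime g) (hb : PolyBounded b) (hR₀ : ∀ a, R a 0 = z a)
    (hR : ∀ a i, R a (i + 1) = g ((a, i), R a i)) (hRb : ∀ a, ∀ i ≤ f a, R a i ≤ b a) :
    Polytime (fun a => R a (f a)) := by
  obtain ⟨hfbound, T, hT, hf⟩ := hf
  obtain ⟨-, U, hU, hz⟩ := hz
  obtain ⟨-, W, hW, hg⟩ := hg
  obtain ⟨V, hV, hWV⟩ := hW.exists_uniform hb.comp_fst
  obtain ⟨B, hB, hVB⟩ := hV.exists_uniform hfbound
  have hWB (a : α) (i : ℕ) (hi : i ≤ f a) : W ((a, i), R a i) ≤ B a :=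
    (hWV _ _ (hRb a i hi)).trans (hVB _ _ hi)
  refine ⟨hb.mono fun a => hRb a _ le_rfl, _,
    hT.add ((PolyBounded.const 1).add (hU.add
      (((hfbound.mul (hB.add (.const 6))).add (.const 1)).add (.const 2)))), fun M ι hι => ?_⟩
  obtain ⟨p, hp⟩ := hf M ι hι
  obtain ⟨q, hq⟩ := hz (M + 2) ι fun i => (hι i).trans (by omega)
  obtain ⟨r, hr⟩ := hg (M + 3) (push (M + 2) (push (M + 1) ι)) (by
    rintro (_ | _ | i)
    exacts [Nat.lt_succ_self _, by simp [push], (hι i).trans (by omega)])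
  refine ⟨.seq p (.seq (.const (M + 1) 0) (.seq q
    (.seq (.while M (recursionStep M r)) (.copy M (M + 2))))), fun a s hs => ?_⟩
  refine (hp a s hs).seq fun s₁ ⟨hagree₁, hval₁⟩ => ?_
  have hagree := hagree₁.setReg M.le_succ 0
  refine ((Run.const (M + 1) 0 s₁).haltsWithin rfl).seq ?_
  rintro _ rfl
  refine (hq a _ (hs.of_agreeBelow hι hagree)).seq fun s₂ ⟨hagree₂, hval₂⟩ => ?_
  have hstart : RecursionState M s (R a) (f a) (f a) s₂ :=
    ⟨hagree.trans (hagree₂.anti (by omega)), by simp [hagree₂.1, Store.reg_setReg, hval₁],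
      by simp [hagree₂.1, Store.reg_setReg], by simp [hagree₂.1, Store.reg_setReg, hval₂, hR₀]⟩
  refine (HaltsWithin.while_countdown (fun _ _ h => h.counter)
    (fun _ _ h => h.step hι hs hr (hR a) (hWB a)) _ _ hstart).seq fun s₃ hend => ?_
  refine (run_copy (by omega) s₃).haltsWithin ⟨hend.agree.setReg le_rfl _, ?_⟩
  have hindex : s₃.reg (M + 1) = f a := hend.index
  simp [Store.reg_setReg, hend.value, hindex]

theorem sum {g : α × ℕ → ℕ} (hf : Polytime f) (hg : Polytime g) :
    Polytime (fun a => ∑ i ∈ Finset.range (f a), g (a, i)) := by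
  obtain ⟨b, hb, hgb⟩ := hg.1.exists_uniform hf.1
  refine recursion (fun a m => ∑ i ∈ Finset.range m, g (a, i)) hf (const 0)
    (snd.add hg.comp_fst) (hf.1.mul hb) (fun _ => rfl)
    (fun _ _ => Finset.sum_range_succ ..) fun a i hi => ?_
  calc ∑ j ∈ Finset.range i, g (a, j) ≤ ∑ _j ∈ Finset.range i, b a :=
        Finset.sum_le_sum fun j hj => hgb a j ((Finset.mem_range.1 hj).le.trans hi)
    _ = i * b a := by simp
    _ ≤ f a * b a := Nat.mul_le_mul_right _ hi

theorem mul (hf : Polytime f) (hg : Polytime g) : Polytime (fun a => f a * g a) := by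
  simpa using hf.sum hg.comp_fst

end Polytime

/-- The predicate `P` is decidable in polynomial time. The answer of the decision procedure is a
number, where `0` stands for acceptance, so that bounded quantification is summation. -/
def PolytimePred (P : α → Prop) : Prop :=
  ∃ f : α → ℕ, Polytime f ∧ ∀ a, P a ↔ f a = 0

namespace PolytimePred

variable {P Q : α → Prop} {f g : α → ℕ}

theorem of_iff (hP : PolytimePred P) (h : ∀ a, Q a ↔ P a) : PolytimePred Q := by
  obtain ⟨f, hf, hfP⟩ := hP
  exact ⟨f, hf, fun a => (h a).trans (hfP a)⟩

theorem comp_fst (hP : PolytimePred P) : PolytimePred (fun x : α × ℕ => P x.1) := by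
  obtain ⟨f, hf, hfP⟩ := hP
  exact ⟨_, hf.comp_fst, fun x => hfP x.1⟩

theorem not (hP : PolytimePred P) : PolytimePred (fun a => ¬ P a) := by
  obtain ⟨f, hf, hfP⟩ := hP
  exact ⟨_, (Polytime.const 1).sub hf, fun a => (hfP a).not.trans (by omega)⟩

theorem and (hP : PolytimePred P) (hQ : PolytimePred Q) : PolytimePred (fun a => P a ∧ Q a) := by
  obtain ⟨f, hf, hfP⟩ := hP
  obtain ⟨g, hg, hgQ⟩ := hQ
  exact ⟨_, hf.add hg, fun a => ((hfP a).and (hgQ a)).trans add_eq_zero.symm⟩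

theorem imp (hP : PolytimePred P) (hQ : PolytimePred Q) : PolytimePred (fun a => P a → Q a) :=
  (hP.and hQ.not).not.of_iff fun _ => not_and_not_right.symm

theorem eq_zero (hf : Polytime f) : PolytimePred (fun a => f a = 0) :=
  ⟨f, hf, fun _ => Iff.rfl⟩

theorem le (hf : Polytime f) (hg : Polytime g) : PolytimePred (fun a => f a ≤ g a) :=
  (eq_zero (hf.sub hg)).of_iff fun _ => Nat.sub_eq_zero_iff_le.symm

theorem eq (hf : Polytime f) (hg : Polytime g) : PolytimePred (fun a => f a = g a) :=
  ((le hf hg).and (le hg hf)).of_iff fun _ => le_antisymm_iff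

theorem forall_lt {P : α → ℕ → Prop} (hf : Polytime f)
    (hP : PolytimePred (fun x : α × ℕ => P x.1 x.2)) :
    PolytimePred (fun a => ∀ i < f a, P a i) := by
  obtain ⟨g, hg, hgP⟩ := hP
  exact ⟨_, hf.sum hg, fun a => by simpa using forall₂_congr fun i _ => hgP (a, i)⟩

theorem exists_lt {P : α → ℕ → Prop} (hf : Polytime f)
    (hP : PolytimePred (fun x : α × ℕ => P x.1 x.2)) :
    PolytimePred (fun a => ∃ i < f a, P a i) :=
  (forall_lt (P := fun a i => ¬ P a i) hf hP.not).not.of_iff fun a => by push Not; rfl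

end PolytimePred

namespace Polytime

variable {f g h : α → ℕ}

theorem ite {P : α → Prop} [DecidablePred P] (hP : PolytimePred P) (hf : Polytime f)
    (hg : Polytime g) : Polytime (fun a => if P a then f a else g a) := by
  obtain ⟨p, hp, hpP⟩ := hP
  have hnot := (const 1).sub hp
  convert (hnot.mul hf).add (((const 1).sub hnot).mul hg) using 2 with a
  by_cases h : p a = 0
  · simp [hpP, h]
  · simp [hpP, h, Nat.sub_eq_zero_of_le (Nat.one_le_iff_ne_zero.2 h)]

theorem count {P : α → ℕ → Prop} [∀ a, DecidablePred (P a)] (hf : Polytime f)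
    (hP : PolytimePred (fun x : α × ℕ => P x.1 x.2)) :
    Polytime (fun a => Nat.count (P a) (f a)) := by
  simpa only [Nat.count_eq_card_filter_range, Finset.card_filter] using
    hf.sum (ite hP (const 1) (const 0))

theorem findGreatest {P : α → ℕ → Prop} [∀ a, DecidablePred (P a)] (hf : Polytime f)
    (hP : PolytimePred (fun x : α × ℕ => P x.1 (x.2 + 1))) :
    Polytime (fun a => Nat.findGreatest (P a) (f a)) :=
  recursion (fun a m => Nat.findGreatest (P a) m) hf (const 0)
    (ite hP.comp_fst (snd.comp_fst.add (const 1)) snd) hf.1 (fun _ => rfl)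
    (fun _ i => Nat.findGreatest_succ i) fun _ i hi => (Nat.findGreatest_le i).trans hi

theorem div (hf : Polytime f) (hg : Polytime g) : Polytime (fun a => f a / g a) := by
  have hfind := hf.findGreatest (P := fun a q => g a ≠ 0 ∧ q * g a ≤ f a)
    ((PolytimePred.eq_zero hg.comp_fst).not.and
      (.le ((snd.add (const 1)).mul hg.comp_fst) hf.comp_fst))
  convert hfind using 2 with a
  refine (Nat.findGreatest_eq_iff.2 ⟨Nat.div_le_self _ _, fun h => ⟨?_, Nat.div_mul_le_self _ _⟩,
    fun q hq _ ⟨hga, hle⟩ => ?_⟩).symm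
  · rintro hga
    simp [hga] at h
  · exact hq.not_ge ((Nat.le_div_iff_mul_le (Nat.pos_of_ne_zero hga)).2 hle)

theorem mod (hf : Polytime f) (hg : Polytime g) : Polytime (fun a => f a % g a) := by
  simpa only [Nat.mod_eq_sub] using hf.sub (hg.mul (hf.div hg))

theorem div_pow (hf : Polytime f) (hg : Polytime g) (hh : Polytime h) :
    Polytime (fun a => f a / g a ^ h a) :=
  recursion (fun a m => f a / g a ^ m) hh hf (snd.div hg.comp_fst.comp_fst) hf.1
    (fun a => by simp) (fun a i => by rw [pow_succ, Nat.div_div_eq_div_mul])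
    fun a i _ => Nat.div_le_self _ _

end Polytime

end Context

end Ram

/-! ### The dimension of a block -/

section BlockTest

/-- The array `A` holds an adjacency matrix of `G` row by row: the entry `A (x * n + y)` vanishes if
and only if `(x, y)` is not an arc. -/
def IsAdjArray {n : ℕ} (A : ℕ → ℕ) (G : Digraph (Fin n)) : Prop :=
  ∀ x y : Fin n, A (x * n + y) = 0 ↔ ¬ G.Adj x y

/-- The numerical form of `IsExcluded`, for the list `u 0, …, u (k - 1)` of rows of the matrix
`A`. -/
def RowTest (A : ℕ → ℕ) (n k : ℕ) (u : ℕ → ℕ) (x y : ℕ) : Prop :=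
  ∃ l < k, u l = x ∧ ∀ l' < k, l ≤ l' → A (u l' * n + y) = 0

/-- The vertex number `j` of the block number `b`, for blocks of `k` consecutive vertices. The last
blocks continue with the vertex `0`, so that all blocks have the same size. -/
def blockRow (n k b j : ℕ) : ℕ :=
  (b * k + j) % n

/-- `blockRow` as a family of vertices. -/
def blockVertex (n k b : ℕ) [NeZero n] (j : Fin k) : Fin n :=
  .ofNat n (b * k + j)

/-- The digit number `m` of `w` in base `k`. -/
def baseDigit (k w m : ℕ) : ℕ :=
  w / k ^ m % k

/-- The digits of `w` in base `k` encode `r` lists of `k` vertices of a block each, such that every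
zero entry of the block is excluded by one of the lists. -/
def ListsExclude (A : ℕ → ℕ) (n k b r w : ℕ) : Prop :=
  ∀ j < k, ∀ y < n, A (blockRow n k b j * n + y) = 0 →
    ∃ i < r, RowTest A n k (fun l => blockRow n k b (baseDigit k w (l + k * i)))
      (blockRow n k b j) y

/-- The numerical form of the statement that the block number `b` is an intersection of `r` Ferrers
digraphs. -/
def BlockTest (A : ℕ → ℕ) (n k b r : ℕ) : Prop :=
  ∃ w < n, ListsExclude A n k b r w

variable {n k b r : ℕ} {A : ℕ → ℕ} {G : Digraph (Fin n)}

theorem rowTest_iff (hA : IsAdjArray A G) {u : ℕ → ℕ} {v : Fin k → Fin n}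
    (huv : ∀ l : Fin k, u l = v l) (x y : Fin n) :
    RowTest A n k u x y ↔ IsExcluded G v x y := by
  have hentry (l : Fin k) : A (u l * n + y) = 0 ↔ ¬ G.Adj (v l) y := by rw [huv, hA]
  constructor
  · rintro ⟨l, hl, hx, hzero⟩
    exact ⟨⟨l, hl⟩, Fin.ext ((huv ⟨l, hl⟩).symm.trans hx),
      fun l' hl' => (hentry l').1 (hzero l' l'.2 hl')⟩
  · rintro ⟨l, rfl, hnot⟩
    exact ⟨l, l.2, huv l, fun l' hlk hl' => (hentry ⟨l', hlk⟩).2 (hnot ⟨l', hlk⟩ hl')⟩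

theorem exists_baseDigit_eq (σ : Fin r → Fin k → Fin k) :
    ∃ w < k ^ (r * k), ∀ (i : Fin r) (l : Fin k), baseDigit k w (l + k * i) = σ i l := by
  let digits : Fin (r * k) → Fin k := Function.uncurry σ ∘ finProdFinEquiv.symm
  refine ⟨finFunctionFinEquiv digits, Fin.is_lt _, fun i l => ?_⟩
  have hdigit := finFunctionFinEquiv_symm_apply_val (finFunctionFinEquiv digits)
    (finProdFinEquiv (i, l))
  have hσ : digits (finProdFinEquiv (i, l)) = σ i l :=
    congrArg (Function.uncurry σ) (finProdFinEquiv.symm_apply_apply _)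
  rw [Equiv.symm_apply_apply, hσ] at hdigit
  exact hdigit.symm

variable [NeZero n]

theorem listsExclude_iff (hA : IsAdjArray A G) {w : ℕ} {σ : Fin r → Fin k → Fin k}
    (hσ : ∀ (i : Fin r) (l : Fin k), baseDigit k w (l + k * i) = σ i l) :
    ListsExclude A n k b r w ↔ ∀ j y, ¬ G.Adj (blockVertex n k b j) y →
      ∃ i, IsExcluded G (blockVertex n k b ∘ σ i) (blockVertex n k b j) y := by
  have hrow (i : Fin r) (j : Fin k) (y : Fin n) := rowTest_iff hA
    (u := fun l => blockRow n k b (baseDigit k w (l + k * i))) (v := blockVertex n k b ∘ σ i)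
    (fun l => by rw [hσ]; rfl) (blockVertex n k b j) y
  simp only [← hA (blockVertex n k b _), ← hrow]
  constructor
  · intro h j y hjy
    obtain ⟨i, hi, htest⟩ := h j j.2 y y.2 hjy
    exact ⟨⟨i, hi⟩, htest⟩
  · intro h j hj y hy hjy
    obtain ⟨i, htest⟩ := h ⟨j, hj⟩ ⟨y, hy⟩ hjy
    exact ⟨i, i.2, htest⟩

theorem blockTest_iff (hA : IsAdjArray A G) (hk : k ^ (k * k) ≤ n) (hr : r ≤ k) :
    BlockTest A n k b r ↔
      IsFerrersIntersection (fillOutside G (Set.range (blockVertex n k b))) r := by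
  rw [isFerrersIntersection_fillOutside_range_iff]
  constructor
  · rintro ⟨w, -, hw⟩
    exact ⟨fun i l => ⟨baseDigit k w (l + k * i), Nat.mod_lt _ l.pos⟩,
      (listsExclude_iff hA fun _ _ => rfl).1 hw⟩
  · rintro ⟨σ, hσ⟩
    obtain ⟨w, hw, hdigit⟩ := exists_baseDigit_eq σ
    refine ⟨w, hw.trans_le (le_trans ?_ hk), (listsExclude_iff hA hdigit).2 hσ⟩
    rcases k.eq_zero_or_pos with rfl | hk₀
    · simp
    · gcongr

open Classical in
/-- The dimension of the block number `b`, computed as the number of failed tests. -/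
noncomputable def blockDim (A : ℕ → ℕ) (n k b : ℕ) : ℕ :=
  Nat.count (fun r => ¬ BlockTest A n k b r) k

theorem blockDim_eq_ferrersDim (hA : IsAdjArray A G) (hk : k ^ (k * k) ≤ n) :
    blockDim A n k b = ferrersDim (fillOutside G (Set.range (blockVertex n k b))) := by
  classical
  have hle := ferrersDim_fillOutside_range_le_card G (blockVertex n k b)
  rw [Fintype.card_fin] at hle
  have htest (r : ℕ) (hr : r ∈ Finset.range k) :
      ¬ BlockTest A n k b r ↔ r < ferrersDim (fillOutside G (Set.range (blockVertex n k b))) := by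
    rw [blockTest_iff hA hk (Finset.mem_range.1 hr).le, ← ferrersDim_le_iff, not_le]
  rw [blockDim, Nat.count_eq_card_filter_range, Finset.filter_congr htest]
  conv_rhs => rw [← Finset.card_range (ferrersDim _)]
  congr 1
  ext r
  simp only [Finset.mem_filter, Finset.mem_range]
  omega

end BlockTest

/-! ### The approximation factor -/

section Approximation

/-- The number of vertices of a block in a digraph on `n` vertices: the largest `k` for which all
families of at most `k` lists of `k` vertices of a block are encoded by the numbers `w < n`. -/
def blockSize (n : ℕ) : ℕ :=
  Nat.findGreatest (fun k => k ^ (k * k) ≤ n) n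

/-- The number of blocks that cover `n` vertices. -/
def numBlocks (n : ℕ) : ℕ :=
  n / blockSize n + 1

/-- The sum of the dimensions of the blocks. -/
noncomputable def approxDim (A : ℕ → ℕ) (n : ℕ) : ℕ :=
  ∑ b ∈ Finset.range (numBlocks n), blockDim A n (blockSize n) b

theorem le_blockSize {n k : ℕ} (h : k ^ (k * k) ≤ n) : k ≤ blockSize n := by
  rcases k.eq_zero_or_pos with rfl | hk
  · exact Nat.zero_le _
  · exact Nat.le_findGreatest ((Nat.le_self_pow (by positivity) k).trans h) h

theorem approxDim_zero (A : ℕ → ℕ) : approxDim A 0 = 0 := by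
  simp [approxDim, blockDim, show blockSize 0 = 0 from rfl]

theorem blockSize_pos (n : ℕ) [NeZero n] : 0 < blockSize n :=
  le_blockSize (by simpa using NeZero.one_le)

theorem blockSize_pow_le (n : ℕ) [NeZero n] : blockSize n ^ (blockSize n * blockSize n) ≤ n :=
  Nat.findGreatest_spec (P := fun k => k ^ (k * k) ≤ n) n.zero_le (by simpa using NeZero.one_le)

theorem iUnion_range_blockVertex (n : ℕ) [NeZero n] :
    ⋃ b ∈ Finset.range (numBlocks n), Set.range (blockVertex n (blockSize n) b) = .univ := by
  refine Set.eq_univ_of_forall fun x => ?_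
  simp only [Set.mem_iUnion, Finset.mem_range]
  refine ⟨x / blockSize n, Nat.lt_succ_of_le (Nat.div_le_div_right x.2.le),
    ⟨x % blockSize n, Nat.mod_lt _ (blockSize_pos n)⟩, ?_⟩
  simp [blockVertex, Nat.div_add_mod']

variable {n : ℕ} {A : ℕ → ℕ} {G : Digraph (Fin n)}

theorem approxDim_eq_sum [NeZero n] (hA : IsAdjArray A G) :
    approxDim A n = ∑ b ∈ Finset.range (numBlocks n),
      ferrersDim (fillOutside G (Set.range (blockVertex n (blockSize n) b))) :=
  Finset.sum_congr rfl fun _ _ => blockDim_eq_ferrersDim hA (blockSize_pow_le n)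

theorem ferrersDim_le_approxDim (hA : IsAdjArray A G) : ferrersDim G ≤ approxDim A n := by
  rcases n.eq_zero_or_pos with rfl | hn
  · exact (ferrersDim_le_iff.2 (isFerrersIntersection_card G)).trans (Nat.zero_le _)
  · have : NeZero n := .of_pos hn
    rw [approxDim_eq_sum hA]
    exact ferrersDim_le_sum_fillOutside G _ _ (iUnion_range_blockVertex n)

theorem approxDim_le (hA : IsAdjArray A G) : approxDim A n ≤ numBlocks n * ferrersDim G := by
  rcases n.eq_zero_or_pos with rfl | hn
  · simp [approxDim_zero]
  · have : NeZero n := .of_pos hn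
    rw [approxDim_eq_sum hA]
    simpa using Finset.sum_le_card_nsmul (Finset.range (numBlocks n)) _ _ fun b _ =>
      ferrersDim_fillOutside_le G (Set.range (blockVertex n (blockSize n) b))

theorem natCast_pow_mul_self_le {x : ℝ} {k : ℕ} (hx : 0 < x) (hlog : 1 ≤ Real.log x)
    (hloglog : 1 ≤ Real.log (Real.log x))
    (hk : (k : ℝ) * k ≤ Real.log x / Real.log (Real.log x)) : (k : ℝ) ^ (k * k) ≤ x := by
  rcases k.eq_zero_or_pos with rfl | hpos
  · simpa using (Real.log_nonneg_iff hx).1 (by linarith)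
  have hk₁ : (1 : ℝ) ≤ k := mod_cast hpos
  have hk_log : Real.log k ≤ Real.log (Real.log x) := by
    refine Real.log_le_log (by positivity) ?_
    calc (k : ℝ) ≤ k * k := le_mul_of_one_le_left (by positivity) hk₁
      _ ≤ Real.log x := hk.trans (div_le_self (by positivity) hloglog)
  rw [← Real.log_le_log_iff (by positivity) hx, Real.log_pow, Nat.cast_mul]
  calc (k : ℝ) * k * Real.log k
      ≤ Real.log x / Real.log (Real.log x) * Real.log (Real.log x) :=
        mul_le_mul hk hk_log (Real.log_nonneg hk₁) (by positivity)
    _ = Real.log x := div_mul_cancel₀ _ (by positivity)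

theorem sqrt_log_div_le_two_mul_blockSize (hlog : 1 ≤ Real.log n)
    (hloglog : 1 ≤ Real.log (Real.log n)) :
    √(Real.log n / Real.log (Real.log n)) ≤ 2 * blockSize n := by
  have hn : n ≠ 0 := by
    rintro rfl
    norm_num at hlog
  have : NeZero n := ⟨hn⟩
  set q := √(Real.log n / Real.log (Real.log n))
  have hfloor : (⌊q⌋₊ : ℝ) * ⌊q⌋₊ ≤ Real.log n / Real.log (Real.log n) := by
    have hle : (⌊q⌋₊ : ℝ) ≤ q := Nat.floor_le (Real.sqrt_nonneg _)
    calc (⌊q⌋₊ : ℝ) * ⌊q⌋₊ ≤ q * q := by gcongr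
      _ = Real.log n / Real.log (Real.log n) := Real.mul_self_sqrt (by positivity)
  have hpow := natCast_pow_mul_self_le (by positivity) hlog hloglog hfloor
  have hsize : (⌊q⌋₊ : ℝ) ≤ blockSize n := mod_cast le_blockSize (mod_cast hpow)
  have hsize₁ : (1 : ℝ) ≤ blockSize n := mod_cast blockSize_pos n
  linarith [Nat.lt_floor_add_one q]

theorem numBlocks_le (n : ℕ) [NeZero n] : (numBlocks n : ℝ) ≤ 2 * (n / blockSize n) := by
  have hpos : (0 : ℝ) < blockSize n := mod_cast blockSize_pos n
  have hle : (blockSize n : ℝ) ≤ n := mod_cast Nat.findGreatest_le n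
  have hone : 1 ≤ (n : ℝ) / blockSize n := (one_le_div hpos).2 hle
  calc (numBlocks n : ℝ) = ((n / blockSize n : ℕ) : ℝ) + 1 := Nat.cast_succ _
    _ ≤ n / blockSize n + n / blockSize n := add_le_add Nat.cast_div_le hone
    _ = 2 * (n / blockSize n) := (two_mul _).symm

theorem numBlocks_isBigO : (fun n => (numBlocks n : ℝ)) =O[atTop] fun n : ℕ =>
    (n : ℝ) * Real.sqrt (Real.log (Real.log n)) / Real.sqrt (Real.log n) := by
  have hlog : Tendsto (fun n : ℕ => Real.log n) atTop atTop :=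
    Real.tendsto_log_atTop.comp tendsto_natCast_atTop_atTop
  have hloglog := Real.tendsto_log_atTop.comp hlog
  refine IsBigO.of_bound 4 ?_
  filter_upwards [hlog.eventually_ge_atTop 1, hloglog.eventually_ge_atTop 1,
    eventually_gt_atTop 0] with n hlog hloglog hn
  have : NeZero n := .of_pos hn
  replace hloglog : 1 ≤ Real.log (Real.log n) := hloglog
  set q := √(Real.log n / Real.log (Real.log n))
  have : 0 < q := by positivity
  have hsize : q / 2 ≤ blockSize n := by
    linarith [sqrt_log_div_le_two_mul_blockSize hlog hloglog]
  rw [← div_div_eq_mul_div, ← Real.sqrt_div (by positivity), Real.norm_of_nonneg (by positivity),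
    Real.norm_of_nonneg (by positivity)]
  calc (numBlocks n : ℝ) ≤ 2 * (n / blockSize n) := numBlocks_le n
    _ ≤ 2 * (n / (q / 2)) := by gcongr
    _ = 4 * (n / q) := by ring

end Approximation

/-! ### The algorithm -/

namespace Ram

section Algorithm

variable {α : Type*} [Context α] {n k b r w j x y m : α → ℕ}

theorem polytime_blockRow (hn : Polytime n) (hk : Polytime k) (hb : Polytime b)
    (hj : Polytime j) : Polytime (fun a => blockRow (n a) (k a) (b a) (j a)) :=
  ((hb.mul hk).add hj).mod hn

theorem polytime_baseDigit (hk : Polytime k) (hw : Polytime w) (hm : Polytime m) :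
    Polytime (fun a => baseDigit (k a) (w a) (m a)) :=
  (hw.div_pow hk hm).mod hk

theorem polytimePred_entry_eq_zero (hn : Polytime n) (hx : Polytime x) (hy : Polytime y) :
    PolytimePred (fun a => Context.cell a (x a * n a + y a) = 0) :=
  .eq_zero ((hx.mul hn).add hy).cell

theorem polytimePred_rowTest {u : α → ℕ → ℕ} (hn : Polytime n) (hk : Polytime k)
    (hu : Polytime (fun c : α × ℕ => u c.1 c.2)) (hx : Polytime x) (hy : Polytime y) :
    PolytimePred (fun a => RowTest (Context.cell a) (n a) (k a) (u a) (x a) (y a)) := by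
  refine .exists_lt hk (.and (.eq hu hx.comp_fst) (.forall_lt hk.comp_fst (.imp ?_ ?_)))
  · exact .le Polytime.snd.comp_fst .snd
  · exact polytimePred_entry_eq_zero hn.comp_fst.comp_fst hu.comp_fst_fst_snd hy.comp_fst.comp_fst

theorem polytimePred_exists_rowTest (hn : Polytime n) (hk : Polytime k) (hb : Polytime b)
    (hr : Polytime r) (hw : Polytime w) (hx : Polytime x) (hy : Polytime y) :
    PolytimePred (fun a => ∃ i < r a, RowTest (Context.cell a) (n a) (k a)
      (fun l => blockRow (n a) (k a) (b a) (baseDigit (k a) (w a) (l + k a * i))) (x a) (y a)) := by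
  have hindex : Polytime (fun c : (α × ℕ) × ℕ => c.2 + k c.1.1 * c.1.2) :=
    Polytime.snd.add (hk.comp_fst.mul .snd).comp_fst
  refine .exists_lt hr (polytimePred_rowTest hn.comp_fst hk.comp_fst ?_ hx.comp_fst hy.comp_fst)
  exact polytime_blockRow hn.comp_fst.comp_fst hk.comp_fst.comp_fst hb.comp_fst.comp_fst
    (polytime_baseDigit hk.comp_fst.comp_fst hw.comp_fst.comp_fst hindex)

theorem polytimePred_listsExclude (hn : Polytime n) (hk : Polytime k) (hb : Polytime b)
    (hr : Polytime r) (hw : Polytime w) :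
    PolytimePred (fun a => ListsExclude (Context.cell a) (n a) (k a) (b a) (r a) (w a)) := by
  have hrow : Polytime (fun c : (α × ℕ) × ℕ => blockRow (n c.1.1) (k c.1.1) (b c.1.1) c.1.2) :=
    (polytime_blockRow hn.comp_fst hk.comp_fst hb.comp_fst .snd).comp_fst
  refine .forall_lt hk (.forall_lt hn.comp_fst (.imp ?_ ?_))
  · exact polytimePred_entry_eq_zero hn.comp_fst.comp_fst hrow .snd
  · exact polytimePred_exists_rowTest hn.comp_fst.comp_fst hk.comp_fst.comp_fst
      hb.comp_fst.comp_fst hr.comp_fst.comp_fst hw.comp_fst.comp_fst hrow .snd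

theorem polytimePred_blockTest (hn : Polytime n) (hk : Polytime k) (hb : Polytime b)
    (hr : Polytime r) :
    PolytimePred (fun a => BlockTest (Context.cell a) (n a) (k a) (b a) (r a)) :=
  .exists_lt hn
    (polytimePred_listsExclude hn.comp_fst hk.comp_fst hb.comp_fst hr.comp_fst .snd)

theorem polytime_blockDim (hn : Polytime n) (hk : Polytime k) (hb : Polytime b) :
    Polytime (fun a => blockDim (Context.cell a) (n a) (k a) (b a)) := by
  classical
  exact .count hk (polytimePred_blockTest hn.comp_fst hk.comp_fst hb.comp_fst .snd).not

theorem polytime_blockSize (hn : Polytime n) : Polytime (fun a => blockSize (n a)) := by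
  have hk : Polytime (fun c : α × ℕ => c.2 + 1) := .add .snd (.const 1)
  refine .findGreatest hn ((PolytimePred.eq_zero
    (hn.comp_fst.div_pow hk (hk.mul hk))).not.of_iff fun c => ?_)
  rw [Nat.div_eq_zero_iff_lt (by positivity), not_lt]

theorem polytime_approxDim (hn : Polytime n) :
    Polytime (fun a => approxDim (Context.cell a) (n a)) :=
  have hsize := polytime_blockSize hn
  .sum ((hn.div hsize).add (.const 1)) (polytime_blockDim hn.comp_fst hsize.comp_fst .snd)

end Algorithm

/-- The inputs of the algorithm: digraphs on `0, …, n - 1` for some `n`. -/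
abbrev DigraphInput : Type :=
  Σ n, Digraph (Fin n)

noncomputable instance : Context DigraphInput where
  var a _ := a.1
  cell a := (input a.2).arr 0
  size a := a.1
  var_le _ _ := le_rfl
  cell_le a i := by
    simp only [input]
    split_ifs <;> simp

theorem isAdjArray_input {n : ℕ} (G : Digraph (Fin n)) : IsAdjArray ((input G).arr 0) G := by
  intro x y
  have hindex (i j : Fin n) : (x : ℕ) * n + y = i * n + j ↔ x = i ∧ y = j := by
    rw [← Prod.mk_inj, ← finProdFinEquiv.injective.eq_iff, Fin.ext_iff]
    simp [add_comm, mul_comm]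
  simp [input, hindex]

theorem Polytime.exists_outputs {f : DigraphInput → ℕ} (hf : Polytime f) :
    ∃ (p : Program) (T : Polynomial ℕ), ∀ (n : ℕ) (G : Digraph (Fin n)),
      Outputs p G (T.eval n) (f ⟨n, G⟩) := by
  obtain ⟨-, U, ⟨T, hT⟩, hf⟩ := hf
  obtain ⟨p, hp⟩ := hf 1 (fun _ => 0) fun _ => Nat.one_pos
  refine ⟨p, T, fun n G => ?_⟩
  obtain ⟨t, s, hrun, ht, -, hs⟩ := hp ⟨n, G⟩ (input G) ⟨fun _ => rfl, rfl⟩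
  exact ⟨t, s, hrun, ht.trans (hT _), hs⟩

end Ram

theorem mainTheorem8 :
    ∃ (p : Ram.Program) (ρ : ℕ → ℝ),
      ρ =O[atTop] (fun n : ℕ =>
        (n : ℝ) * Real.sqrt (Real.log (Real.log n)) / Real.sqrt (Real.log n)) ∧
      Ram.IsPolyTimeApprox p ferrersDim ρ := by
  obtain ⟨p, T, hp⟩ :=
    (Ram.polytime_approxDim (Ram.Polytime.var (α := Ram.DigraphInput) 0)).exists_outputs
  refine ⟨p, fun n => numBlocks n, numBlocks_isBigO, T, fun n G => ⟨_, hp n G, ?_, ?_⟩⟩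
  · exact ferrersDim_le_approxDim (Ram.isAdjArray_input G)
  · exact (Nat.cast_le.2 (approxDim_le (Ram.isAdjArray_input G))).trans_eq (Nat.cast_mul _ _)
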